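/- Let $n\ge 0$ and let $[n]=\{1<\dots<n\}$. A Young tableau over $[n]$ is a finite sequence of nonempty top-justified columns of weakly decreasing lengths, filled with elements of $[n]$, strictly increasing down columns and weakly increasing along rows. Let $D_n$ be the set of Young tableaux over $[n]$, let $\emptyset$ be the empty tableau, and let $R:D_n\to[n]^*$ be the south-west reading, which reads the columns from left to right, each one from bottom to top. Schensted's right insertion $t\leftarrow x$ inserts $x$ in the first row of $t$: if some entry of the row is $>x$, the leftmost such entry is replaced by $x$ and is inserted in the same way in the next row; otherwise $x$ is added at the end of the row. Schensted's left insertion $x\to t$ inserts $x$ in the first column of $t$: if some entry of the column is $\ge x$, the topmost such entry is replaced by $x$ and is inserted in the same way in the next column; otherwise $x$ is added at the bottom of the column. For a word $u=x_1\cdots x_k$ put $(t\leftarrow u)=((t\leftarrow x_1)\leftarrow\cdots)\leftarrow x_k$ and $(u\to t)=x_1\to(\cdots\to(x_k\to t))$. Then $(D_n,\emptyset,\leftarrow,R)$ and $(D_n,\emptyset,\to,R)$ are a right and a left string data structure, that is, $R$ is injective, $R(\emptyset)$ is the empty word, $R(\emptyset\leftarrow x)=x=R(x\to\emptyset)$ for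 all $x\in[n]$, and $(\emptyset\leftarrow R(t))=t=(R(t)\to\emptyset)$ for all $t\in D_n$. The two insertions commute: $$y\to(t\leftarrow x)=(y\to t)\leftarrow x\qquad\text{for all } t\in D_n,\ x,y\in[n].$$ The product $t\star t'=(t\leftarrow R(t'))$ on $D_n$ is associative, with unit $\emptyset$, and the resulting monoid (the structure monoid $\mathbf M(\mathbf{Yrow}_n)$) is isomorphic to the plactic monoid $\mathbf P_n$, that is, to the monoid presented by the generators $[n]$ and the Knuth relations $zxy=xzy$ for $1\le x\le y<z\le n$ and $yzx=yxz$ for $1\le x<y\le z\le n$. -/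

import Mathlib

/-! ## String data structures over `[n]`

The alphabet `[n]` is `Fin n`; words over `[n]` are lists. -/

section StringData

variable {n : ℕ} {D : Type*}

/-- Right insertion of a word `x₁ x₂ … x_k`: the letters are inserted in the order
`x₁, x₂, …, x_k`. -/
def insertWordRight (I : D → Fin n → D) (d : D) (u : List (Fin n)) : D :=
  u.foldl I d

/-- Left insertion of a word `x₁ x₂ … x_k`: the letters are inserted in the order
`x_k, …, x₂, x₁`. -/
def insertWordLeft (J : D → Fin n → D) (u : List (Fin n)) (d : D) : D :=
  u.foldr (fun x d' => J d' x) d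

/-- `(D, I, R)` with distinguished element `e` is a right string data structure. -/
structure IsRightStringDataStructure (e : D) (I : D → Fin n → D) (R : D → List (Fin n)) :
    Prop where
  read_insert : ∀ x, R (I e x) = [x]
  insert_read : ∀ d, insertWordRight I e (R d) = d
  read_injective : Function.Injective R
  read_empty : R e = []

/-- `(D, J, R)` with distinguished element `e` is a left string data structure. -/
structure IsLeftStringDataStructure (e : D) (J : D → Fin n → D) (R : D → List (Fin n)) :
    Prop where
  read_insert : ∀ x, R (J e x) = [x]
  insert_read : ∀ d, insertWordLeft J (R d) e = d
  read_injective : Function.Injective R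
  read_empty : R e = []

/-- A right insertion `I` and a left insertion `J` commute:
`y → (d ← x) = (y → d) ← x` for all `d`, `x`, `y`. -/
def InsertionsCommute (I J : D → Fin n → D) : Prop :=
  ∀ (d : D) (x y : Fin n), J (I d x) y = I (J d y) x

/-- The product `d ⋆ d' = (d ← R d')` of a right string data structure. -/
def insertionProduct (I : D → Fin n → D) (R : D → List (Fin n)) (d d' : D) : D :=
  insertWordRight I d (R d')

/-- A right string data structure is associative if its product is. -/
structure IsAssocRightStringDataStructure (e : D) (I : D → Fin n → D)
    (R : D → List (Fin n)) : Prop extends IsRightStringDataStructure e I R where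
  product_assoc : ∀ a b c, insertionProduct I R (insertionProduct I R a b) c =
    insertionProduct I R a (insertionProduct I R b c)

/-- The underlying set of the structure monoid of an associative right string data structure. -/
def StructureMonoid {e : D} {I : D → Fin n → D} {R : D → List (Fin n)}
    (_h : IsAssocRightStringDataStructure e I R) : Type _ := D

/-- The structure monoid: the product is `⋆` and the unit is the distinguished element. -/
instance StructureMonoid.instMonoid {e : D} {I : D → Fin n → D} {R : D → List (Fin n)}
    (h : IsAssocRightStringDataStructure e I R) : Monoid (StructureMonoid h) where
  mul := insertionProduct I R
  mul_assoc := h.product_assoc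
  one := e
  one_mul := h.insert_read
  mul_one a := by
    change insertWordRight I a (R e) = a
    rw [h.read_empty]
    rfl

end StringData

/-! ## The plactic monoid -/

/-- The Knuth relations on words over `[n]`. -/
inductive KnuthRel (n : ℕ) : FreeMonoid (Fin n) → FreeMonoid (Fin n) → Prop
  | zxy (x y z : Fin n) : x ≤ y → y < z →
      KnuthRel n (.of z * .of x * .of y) (.of x * .of z * .of y)
  | yzx (x y z : Fin n) : x < y → y ≤ z →
      KnuthRel n (.of y * .of z * .of x) (.of y * .of x * .of z)

/-- The plactic monoid of rank `n`. -/
abbrev PlacticMonoid (n : ℕ) : Type := PresentedMonoid (KnuthRel n)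

/-! ## Tableaux as lists of lines

A tableau is written as the list of its columns, from left to right, each column being listed
from top to bottom; or else as the list of its rows, from top to bottom, each row being listed
from left to right. -/

section Lines

variable {α : Type*}

/-- The line `m`, placed next to the line `l` with first boxes aligned, is at most as long as `l`,
and each of its entries is `s`-related to its neighbour in `l`. -/
def Beside (s : α → α → Prop) : List α → List α → Prop
  | _, [] => True
  | [], _ :: _ => False
  | a :: l, b :: m => s a b ∧ Beside s l m

/-- A list of nonempty lines, each of them `r`-increasing, in which successive lines are aligned
at their first boxes, have weakly decreasing lengths and are `s`-increasing across. -/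
def IsTableau (r s : α → α → Prop) (L : List (List α)) : Prop :=
  (∀ l ∈ L, l ≠ [] ∧ l.Pairwise r) ∧ L.IsChain (Beside s)

/-- Put the column `c`, top-justified, to the left of the rows `L`. -/
def addColumn : List α → List (List α) → List (List α)
  | [], L => L
  | a :: c, [] => [a] :: addColumn c []
  | a :: c, l :: L => (a :: l) :: addColumn c L

/-- The list of rows of a tableau given by its columns (and conversely). -/
def transposeLines (L : List (List α)) : List (List α) := L.foldr addColumn []

/-- Insert `x` in a line: the first entry `a` with `s x a` is replaced by `x` and returned;
if there is none, `x` is added at the end. -/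
def bump (s : α → α → Prop) [DecidableRel s] (x : α) : List α → List α × Option α
  | [] => ([x], none)
  | a :: l => if s x a then (x :: l, some a) else (a :: (bump s x l).1, (bump s x l).2)

/-- Insert `x` in the first line, the entry bumped out of it in the second line, and so on,
until nothing is bumped. -/
def insertLines (s : α → α → Prop) [DecidableRel s] : List (List α) → α → List (List α)
  | [], x => [[x]]
  | l :: L, x =>
    match bump s x l with
    | (l', none) => l' :: L
    | (l', some y) => l' :: insertLines s L y

theorem isTableau_nil (r s : α → α → Prop) : IsTableau r s [] := by
  simp [IsTableau]

theorem isTableau_cons {r s : α → α → Prop} {l : List α} {L : List (List α)} :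
    IsTableau r s (l :: L) ↔
      (l ≠ [] ∧ l.Pairwise r) ∧ Beside s l (L.headD []) ∧ IsTableau r s L := by
  cases L with
  | nil => simp [IsTableau, Beside]
  | cons m L =>
    simp only [IsTableau, List.forall_mem_cons, List.isChain_cons_cons, List.headD_cons]
    tauto

theorem isTableau_addColumn {r s : α → α → Prop} (hr : ∀ ⦃a b c⦄, r a b → r b c → r a c) :
    ∀ (c : List α) (L : List (List α)), c.Pairwise s → IsTableau r s L →
      Beside r c (L.filterMap List.head?) →
      IsTableau r s (addColumn c L) ∧ (addColumn c L).filterMap List.head? = c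
  | [], [], _, hL, _ => ⟨hL, rfl⟩
  | [], l :: L, _, hL, h => by
    obtain ⟨⟨h1, -⟩, -⟩ := isTableau_cons.1 hL
    cases l with
    | nil => exact absurd rfl h1
    | cons b l => exact h.elim
  | a :: c, [], hc, hL, _ => by
    obtain ⟨h1, h2⟩ := isTableau_addColumn hr c [] (List.pairwise_cons.1 hc).2 hL
      (by simp [Beside])
    refine ⟨isTableau_cons.2 ⟨⟨by simp, by simp⟩, ?_, h1⟩, by simpa [addColumn] using h2⟩
    cases c with
    | nil => simp [addColumn, Beside]
    | cons b c => simpa [addColumn, Beside] using (List.pairwise_cons.1 hc).1 b (by simp)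
  | a :: c, l :: L, hc, hL, h => by
    obtain ⟨⟨h1, h2⟩, h3, h4⟩ := isTableau_cons.1 hL
    cases l with
    | nil => exact absurd rfl h1
    | cons b l =>
      obtain ⟨hab, h⟩ : r a b ∧ Beside r c (L.filterMap List.head?) := by
        simpa [Beside] using h
      obtain ⟨h5, h6⟩ := isTableau_addColumn hr c L (List.pairwise_cons.1 hc).2 h4 h
      refine ⟨isTableau_cons.2 ⟨⟨by simp, ?_⟩, ?_, h5⟩, by simpa [addColumn] using h6⟩
      · refine List.pairwise_cons.2 ⟨fun z hz => ?_, h2⟩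
        rcases List.mem_cons.1 hz with rfl | hz
        · exact hab
        · exact hr hab ((List.pairwise_cons.1 h2).1 z hz)
      · cases c with
        | nil =>
          cases L with
          | nil => simp [addColumn, Beside]
          | cons m L =>
            cases m with
            | nil => simp [addColumn, Beside]
            | cons b' m => simp [Beside] at h
        | cons a' c =>
          have haa' : s a a' := (List.pairwise_cons.1 hc).1 a' (by simp)
          cases L with
          | nil => simpa [addColumn, Beside] using haa'
          | cons m L => exact ⟨haa', h3⟩

theorem isTableau_transposeLines {r s : α → α → Prop}
    (hs : ∀ ⦃a b c⦄, s a b → s b c → s a c) {L : List (List α)} (hL : IsTableau r s L) :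
    IsTableau s r (transposeLines L) := by
  suffices h : IsTableau s r (transposeLines L) ∧
      (transposeLines L).filterMap List.head? = L.headD [] from h.1
  induction L with
  | nil => exact ⟨isTableau_nil _ _, rfl⟩
  | cons c L ih =>
    obtain ⟨⟨-, h2⟩, h3, h4⟩ := isTableau_cons.1 hL
    obtain ⟨h5, h6⟩ := ih h4
    exact isTableau_addColumn hs c _ h2 h5 (h6 ▸ h3)

section Bump

variable {r s : α → α → Prop} [DecidableRel s]

theorem bump_ne_nil (x : α) (l : List α) : (bump s x l).1 ≠ [] := by
  cases l with
  | nil => simp [bump]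
  | cons a l => by_cases h : s x a <;> simp [bump, h]

theorem bump_mem {x z : α} {l : List α} (hz : z ∈ (bump s x l).1) : z = x ∨ z ∈ l := by
  induction l with
  | nil => simpa [bump] using hz
  | cons a l ih =>
    by_cases h : s x a
    · simp only [bump, h, if_true, List.mem_cons] at hz ⊢
      tauto
    · simp only [bump, h, if_false, List.mem_cons] at hz ⊢
      tauto

theorem bump_rel {x y : α} {l : List α} (hy : (bump s x l).2 = some y) : s x y := by
  induction l with
  | nil => simp [bump] at hy
  | cons a l ih =>
    by_cases h : s x a
    · simp only [bump, h, if_true, Option.some.injEq] at hy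
      exact hy ▸ h
    · simp only [bump, h, if_false] at hy
      exact ih hy

theorem bump_pairwise (hsr : ∀ ⦃a b c⦄, s a b → r b c → r a c)
    (hn : ∀ ⦃a b⦄, ¬ s a b → r b a) {x : α} {l : List α} (hl : l.Pairwise r) : (bump s x l).1.Pairwise r := by
  induction l with
  | nil => simp [bump]
  | cons a l ih =>
    obtain ⟨h1, h2⟩ := List.pairwise_cons.1 hl
    by_cases h : s x a
    · simp only [bump, h, if_true]
      exact List.pairwise_cons.2 ⟨fun z hz => hsr h (h1 z hz), h2⟩
    · simp only [bump, h, if_false]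
      refine List.pairwise_cons.2 ⟨fun z hz => ?_, ih h2⟩
      rcases bump_mem hz with rfl | hz
      · exact hn h
      · exact h1 z hz

theorem beside_bump_left (hs : ∀ ⦃a b c⦄, s a b → s b c → s a c) {x : α} :
    ∀ {l m : List α}, Beside s l m → Beside s (bump s x l).1 m
  | _, [], _ => by simp [Beside]
  | [], _ :: _, h => h.elim
  | a :: l, b :: m, h => by
    by_cases hx : s x a
    · simp only [bump, hx, if_true]
      exact ⟨hs hx h.1, h.2⟩
    · simp only [bump, hx, if_false]
      exact ⟨h.1, beside_bump_left hs h.2⟩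

theorem beside_bump_bump (hs : ∀ ⦃a b c⦄, s a b → s b c → s a c)
    (hrs : ∀ ⦃a b c⦄, r a b → s b c → s a c) (hn : ∀ ⦃a b⦄, ¬ s a b → r b a) {x y : α} :
    ∀ {l m : List α}, Beside s l m → (bump s x l).2 = some y →
      Beside s (bump s x l).1 (bump s y m).1
  | [], _, _, hy => by simp [bump] at hy
  | a :: l, m, h, hy => by
    have hxy := bump_rel hy
    by_cases hx : s x a
    · simp only [bump, hx, if_true, Option.some.injEq] at hy ⊢
      subst hy
      cases m with
      | nil => exact ⟨hx, by simp [Beside]⟩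
      | cons b m =>
        simp only [bump, h.1, if_true]
        exact ⟨hx, h.2⟩
    · simp only [bump, hx, if_false] at hy ⊢
      cases m with
      | nil => exact ⟨hrs (hn hx) hxy, by simp [Beside]⟩
      | cons b m =>
        by_cases hb : s y b
        · simp only [bump, hb, if_true]
          exact ⟨hrs (hn hx) hxy, beside_bump_left hs h.2⟩
        · simp only [bump, hb, if_false]
          exact ⟨h.1, beside_bump_bump hs hrs hn h.2 hy⟩

theorem headD_insertLines (L : List (List α)) (x : α) :
    (insertLines s L x).headD [] = (bump s x (L.headD [])).1 := by
  cases L with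
  | nil => simp [insertLines, bump]
  | cons l L =>
    rcases h : bump s x l with ⟨l', _ | y⟩ <;> simp [insertLines, h]

theorem isTableau_insertLines (hs : ∀ ⦃a b c⦄, s a b → s b c → s a c)
    (hrs : ∀ ⦃a b c⦄, r a b → s b c → s a c) (hsr : ∀ ⦃a b c⦄, s a b → r b c → r a c)
    (hn : ∀ ⦃a b⦄, ¬ s a b → r b a) {L : List (List α)} (hL : IsTableau r s L) (x : α) :
    IsTableau r s (insertLines s L x) := by
  induction L generalizing x with
  | nil => simp [insertLines, IsTableau]
  | cons l L ih =>
    obtain ⟨⟨-, h2⟩, h3, h4⟩ := isTableau_cons.1 hL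
    have h1 := bump_ne_nil (s := s) x l
    have h5 := bump_pairwise (s := s) (x := x) hsr hn h2
    have h6 := beside_bump_left hs (x := x) h3
    have h7 := fun y => beside_bump_bump hs hrs hn (x := x) (y := y) h3
    rcases h : bump s x l with ⟨l', _ | y⟩
    · rw [h] at h1 h5 h6
      simp only [insertLines, h]
      exact isTableau_cons.2 ⟨⟨h1, h5⟩, h6, h4⟩
    · rw [h] at h1 h5 h7
      simp only [insertLines, h]
      exact isTableau_cons.2 ⟨⟨h1, h5⟩, headD_insertLines (s := s) L y ▸ h7 y rfl, ih h4 y⟩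

end Bump

end Lines

/-! ## Young tableaux and Schensted's insertions -/

/-- A Young tableau over `[n]`: a list of nonempty, top-justified columns of weakly decreasing
lengths, strictly increasing down columns and weakly increasing along rows. -/
def YoungTableau (n : ℕ) : Type :=
  {t : List (List (Fin n)) // IsTableau (· < ·) (· ≤ ·) t}

namespace YoungTableau

variable {n : ℕ}

/-- The empty tableau. -/
def empty (n : ℕ) : YoungTableau n := ⟨[], isTableau_nil _ _⟩

/-- The south-west reading: columns from left to right, each one from bottom to top. -/
def readSW (t : YoungTableau n) : List (Fin n) := (t.1.map List.reverse).flatten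

/-- Schensted's right insertion `t ← x`: in each row, starting from the first one, the leftmost
entry `> x` is replaced by `x` and inserted in the next row; if there is none, `x` is added at the
end of the row. -/
def rightInsert (t : YoungTableau n) (x : Fin n) : YoungTableau n :=
  ⟨transposeLines (insertLines (· < ·) (transposeLines t.1) x),
    isTableau_transposeLines (r := (· ≤ ·)) (s := (· < ·)) (fun _ _ _ => lt_trans)
      (isTableau_insertLines (r := (· ≤ ·)) (s := (· < ·)) (fun _ _ _ => lt_trans)
        (fun _ _ _ => lt_of_le_of_lt) (fun _ _ _ h h' => h.le.trans h') (fun _ _ => not_lt.1)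
        (isTableau_transposeLines (r := (· < ·)) (s := (· ≤ ·)) (fun _ _ _ => le_trans) t.2) x)⟩

/-- Schensted's left insertion `x → t`: in each column, starting from the first one, the topmost
entry `≥ x` is replaced by `x` and inserted in the next column; if there is none, `x` is added at
the bottom of the column. -/
def leftInsert (t : YoungTableau n) (x : Fin n) : YoungTableau n :=
  ⟨insertLines (· ≤ ·) t.1 x,
    isTableau_insertLines (r := (· < ·)) (s := (· ≤ ·)) (fun _ _ _ => le_trans)
      (fun _ _ _ h h' => h.le.trans h') (fun _ _ _ => lt_of_le_of_lt) (fun _ _ => not_le.1) t.2 x⟩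

end YoungTableau

/-! Send a tableau `t` to the class `toPlactic t` of its column reading in the plactic monoid.
Everything follows once this map is a bijection that turns left insertion into left multiplication
and right insertion into right multiplication: commutation of the insertions and associativity of
the product are then associativity in the plactic monoid.

Multiplicativity on the left is a computation with Knuth relations, column by column (`mul_column`).
On the right the same is done row by row (`row_mul`), for the row reading, which has the same class
as the column reading (`rowProduct_transposeLines`).

Injectivity uses left insertion only. It respects the Knuth relations
(`foldl_insertLines_knuth_zxy`, `foldl_insertLines_knuth_yzx`), so the plactic monoid acts on
tableaux. Inserting the reading of `t` in the empty tableau rebuilds `t`, so the class of the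
reading, acting on the empty tableau, determines `t`. Surjectivity holds because inserting any word
yields a tableau in the class of that word. -/

section PlacticTableaux

variable {α : Type*}

/-! ### Inserting a word in a line -/

section BumpAll

variable {s : α → α → Prop} [DecidableRel s]

theorem bump_snd_mem {x y : α} {l : List α} (h : (bump s x l).2 = some y) : y ∈ l := by
  induction l with
  | nil => simp [bump] at h
  | cons a l ih =>
    by_cases hx : s x a
    · simp_all [bump]
    · simp only [bump, hx, if_false] at h
      exact List.mem_cons_of_mem _ (ih h)

/-- The first entry of a line after an insertion that bumps `y` is `s`-related to `y`. -/
theorem exists_bump_eq_cons {r : α → α → Prop} (hrs : ∀ ⦃a b c⦄, r a b → s b c → s a c)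
    (hn : ∀ ⦃a b⦄, ¬ s a b → r b a) {x y : α} {l : List α} (h : (bump s x l).2 = some y) :
    ∃ b m, (bump s x l).1 = b :: m ∧ s b y := by
  have hxy := bump_rel h
  cases l with
  | nil => simp [bump] at h
  | cons a l =>
    by_cases hx : s x a
    · exact ⟨x, l, by simp [bump, hx], hxy⟩
    · exact ⟨a, (bump s x l).1, by simp [bump, hx], hrs (hn hx) hxy⟩

/-- Insert the letters of a word successively in a line; the second component is the word of the
bumped letters, in the order in which they are bumped. -/
def bumpAll (s : α → α → Prop) [DecidableRel s] : List α → List α → List α × List α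
  | l, [] => (l, [])
  | l, x :: w => ((bumpAll s (bump s x l).1 w).1,
      (bump s x l).2.toList ++ (bumpAll s (bump s x l).1 w).2)

/-- The later lines see only the word of bumped letters, so statements about tableaux reduce to
`bumpAll` on a single line and induction. -/
theorem foldl_insertLines_cons (w : List α) (l : List α) (L : List (List α)) :
    w.foldl (insertLines s) (l :: L) =
      (bumpAll s l w).1 :: (bumpAll s l w).2.foldl (insertLines s) L := by
  induction w generalizing l L with
  | nil => rfl
  | cons x w ih =>
    rcases h : bump s x l with ⟨l', _ | y⟩ <;> simp [insertLines, bumpAll, h, ih]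

theorem foldl_insertLines_nil {w : List α} (hw : w ≠ []) :
    w.foldl (insertLines s) [] = w.foldl (insertLines s) [[]] := by
  cases w with
  | nil => exact absurd rfl hw
  | cons x w => simp [insertLines, bump]

theorem bumpAll_cons_of_forall_not {a : α} {w : List α} (h : ∀ x ∈ w, ¬ s x a) (l : List α) :
    bumpAll s (a :: l) w = (a :: (bumpAll s l w).1, (bumpAll s l w).2) := by
  induction w generalizing l with
  | nil => rfl
  | cons x w ih =>
    simp only [List.forall_mem_cons] at h
    simp [bumpAll, bump, h.1, ih h.2]

end BumpAll

/-! ### Inserting words in columns -/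

section Columns

variable [LinearOrder α]

/-- The letters of `c` arrive from top to bottom. Each exceeds the letters of `c` already in place,
and so bumps its right neighbour in `d`, or is added at the bottom when `d` is exhausted. -/
theorem bumpAll_column : ∀ {c d : List α}, c.Pairwise (· < ·) → Beside (· ≤ ·) c d →
    bumpAll (· ≤ ·) d c = (c, d)
  | [], [], _, _ => rfl
  | [], _ :: _, _, h => h.elim
  | a :: c, [], hc, _ => by
    obtain ⟨h1, h2⟩ := List.pairwise_cons.1 hc
    simp [bumpAll, bump, bumpAll_cons_of_forall_not (s := (· ≤ ·)) (fun x hx => not_le.2 (h1 x hx)),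
      bumpAll_column h2 (d := []) (by simp [Beside])]
  | a :: c, b :: d, hc, h => by
    obtain ⟨h1, h2⟩ := List.pairwise_cons.1 hc
    simp [bumpAll, bump, bumpAll_cons_of_forall_not (s := (· ≤ ·)) (fun x hx => not_le.2 (h1 x hx)),
      bumpAll_column h2 h.2, h.1]

theorem foldl_insertLines_column {c : List α} {L : List (List α)}
    (h : IsTableau (· < ·) (· ≤ ·) (c :: L)) : c.foldl (insertLines (· ≤ ·)) L = c :: L := by
  induction L generalizing c with
  | nil =>
    obtain ⟨⟨h1, h2⟩, -, -⟩ := isTableau_cons.1 h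
    rw [foldl_insertLines_nil h1, foldl_insertLines_cons, bumpAll_column h2 (by simp [Beside])]
    rfl
  | cons d L ih =>
    obtain ⟨⟨-, h2⟩, h3, h4⟩ := isTableau_cons.1 h
    rw [foldl_insertLines_cons, bumpAll_column h2 (d := d) h3, ih h4]

/-! ### Left insertion respects the Knuth relations. -/

/-- The larger letter `z` passes the box where `y` stopped, so what it bumps lies strictly lower in
the original column. -/
theorem bump_bump_of_lt {y z b : α} (hyz : y < z) {l : List α} (hl : l.Pairwise (· < ·))
    (h : (bump (· ≤ ·) z (bump (· ≤ ·) y l).1).2 = some b) :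
    ∃ a, (bump (· ≤ ·) y l).2 = some a ∧ a < b := by
  induction l with
  | nil => simp [bump, not_le.2 hyz] at h
  | cons c l ih =>
    obtain ⟨h1, h2⟩ := List.pairwise_cons.1 hl
    by_cases hy : y ≤ c
    · simp only [bump, hy, if_true, not_le.2 hyz, if_false] at h ⊢
      exact ⟨c, rfl, h1 b (bump_snd_mem h)⟩
    · have hz : ¬ z ≤ c := fun hz => hy (hyz.le.trans hz)
      simp only [bump, hy, hz, if_false] at h ⊢
      exact ih h2 h

/-- After its insertion `z` is in the line and all entries before it are `< z`; the letter `y` stops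
at `z` or earlier. -/
theorem exists_bump_bump_of_le {y z : α} (hyz : y ≤ z) (l : List α) :
    ∃ a, (bump (· ≤ ·) y (bump (· ≤ ·) z l).1).2 = some a ∧ a ≤ z := by
  induction l with
  | nil => simp [bump, hyz]
  | cons c l ih =>
    by_cases hz : z ≤ c
    · simp [bump, hz, hyz]
    · by_cases hy : y ≤ c
      · simp [bump, hz, hy, (not_le.1 hz).le]
      · simpa [bump, hz, hy] using ih

/-- The words are reversed because left insertion starts with the last letter. The bumped words are
either equal or related by the same Knuth relation, which lets the induction pass to the next
column. -/
theorem bumpAll_knuth_zxy {x y z : α} (hxy : x ≤ y) (hyz : y < z) {c : List α}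
    (hc : c.Pairwise (· < ·)) :
    (bumpAll (· ≤ ·) c [y, x, z]).1 = (bumpAll (· ≤ ·) c [y, z, x]).1 ∧
      ((bumpAll (· ≤ ·) c [y, x, z]).2 = (bumpAll (· ≤ ·) c [y, z, x]).2 ∨
        ∃ x' y' z', x' ≤ y' ∧ y' < z' ∧ (bumpAll (· ≤ ·) c [y, x, z]).2 = [y', x', z'] ∧
          (bumpAll (· ≤ ·) c [y, z, x]).2 = [y', z', x']) := by
  have hxz := hxy.trans_lt hyz
  have hzy := not_le.2 hyz
  have hzx := not_le.2 hxz
  induction c with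
  | nil => simp [bumpAll, bump, hxy, hzy, hzx]
  | cons a l ih =>
    obtain ⟨h1, h2⟩ := List.pairwise_cons.1 hc
    by_cases hy : y ≤ a
    · rcases hb : bump (· ≤ ·) z l with ⟨l', _ | b⟩
      · simp [bumpAll, bump, hxy, hzy, hzx, hy, hb]
      · have hab : a < b := h1 b (bump_snd_mem (s := (· ≤ ·)) (x := z) (by rw [hb]))
        exact ⟨by simp [bumpAll, bump, hxy, hzy, hzx, hy, hb],
          Or.inr ⟨y, a, b, hy, hab, by simp [bumpAll, bump, hxy, hzy, hzx, hy, hb]⟩⟩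
    · have hz : ¬ z ≤ a := fun hz => hy (hyz.le.trans hz)
      by_cases hx : x ≤ a
      · have key := fun b => bump_bump_of_lt (b := b) hyz h2
        rcases hb : bump (· ≤ ·) y l with ⟨l₁, o⟩
        rcases hb' : bump (· ≤ ·) z l₁ with ⟨l₂, _ | b⟩
        · simp [bumpAll, bump, hy, hz, hx, hb, hb', hzx]
        · obtain ⟨b', h3, h4⟩ := key b (by rw [hb, hb'])
          obtain rfl : o = some b' := by rw [hb] at h3; exact h3
          have hab : a < b' := h1 b' (bump_snd_mem (s := (· ≤ ·)) (x := y) (by rw [hb]))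
          exact ⟨by simp [bumpAll, bump, hy, hz, hx, hb, hb', hzx],
            Or.inr ⟨a, b', b, hab.le, h4, by simp [bumpAll, bump, hy, hz, hx, hb, hb', hzx]⟩⟩
      · rw [bumpAll_cons_of_forall_not (s := (· ≤ ·)) (by simp_all),
          bumpAll_cons_of_forall_not (s := (· ≤ ·)) (by simp_all)]
        simpa using ih h2

/-- Unlike in `bumpAll_knuth_zxy`, the type of the relation between the bumped words may change;
since the other type reproduces itself, the induction over columns still closes. -/
theorem bumpAll_knuth_yzx {x y z : α} (hxy : x < y) (hyz : y ≤ z) {c : List α}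
    (hc : c.Pairwise (· < ·)) :
    (bumpAll (· ≤ ·) c [x, z, y]).1 = (bumpAll (· ≤ ·) c [z, x, y]).1 ∧
      ((bumpAll (· ≤ ·) c [x, z, y]).2 = (bumpAll (· ≤ ·) c [z, x, y]).2 ∨
        (∃ x' y' z', x' < y' ∧ y' ≤ z' ∧ (bumpAll (· ≤ ·) c [x, z, y]).2 = [x', z', y'] ∧
          (bumpAll (· ≤ ·) c [z, x, y]).2 = [z', x', y']) ∨
        ∃ x' y' z', x' ≤ y' ∧ y' < z' ∧ (bumpAll (· ≤ ·) c [x, z, y]).2 = [y', z', x'] ∧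
          (bumpAll (· ≤ ·) c [z, x, y]).2 = [y', x', z']) := by
  have hxz := hxy.trans_le hyz
  have hyx := not_le.2 hxy
  have hzx := not_le.2 hxz
  induction c with
  | nil => simp [bumpAll, bump, hyz, hzx, hyx, hxz.le]
  | cons a l ih =>
    obtain ⟨h1, h2⟩ := List.pairwise_cons.1 hc
    by_cases hz : z ≤ a
    · have hx : x ≤ a := hxz.le.trans hz
      cases l with
      | nil => simp [bumpAll, bump, hx, hz, hyz, hzx, hyx, hxz.le]
      | cons b l =>
        have hab : a < b := h1 b (by simp)
        have hzb : z ≤ b := hz.trans hab.le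
        have hyb : y ≤ b := hyz.trans hzb
        -- The type changes here: `z` is itself bumped, by `y` in one order and by `x` in the other,
        -- and the bumped words are `a b z` and `a z b` with `z ≤ a < b`.
        refine ⟨by simp [bumpAll, bump, hx, hz, hyz, hzx, hyx, hxz.le, hzb, hyb],
          Or.inr (Or.inr ⟨z, a, b, hz, hab, ?_⟩)⟩
        simp [bumpAll, bump, hx, hz, hyz, hzx, hyx, hxz.le, hzb, hyb]
    · by_cases hx : x ≤ a
      · obtain ⟨b, h3, h4⟩ := exists_bump_bump_of_le hyz l
        rcases hb : bump (· ≤ ·) z l with ⟨l₁, o⟩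
        rw [hb] at h3
        rcases hb' : bump (· ≤ ·) y l₁ with ⟨l₂, o'⟩
        obtain rfl : o' = some b := by rw [hb'] at h3; exact h3
        have hab : a < b := by
          have h5 : b ∈ (bump (· ≤ ·) z l).1 := by rw [hb]; exact bump_snd_mem h3
          rcases bump_mem h5 with rfl | h5
          · exact not_le.1 hz
          · exact h1 b h5
        cases o with
        | none => simp [bumpAll, bump, hx, hz, hyx, hzx, hb, hb']
        | some b' =>
          have hzb : z ≤ b' := bump_rel (s := (· ≤ ·)) (l := l) (by rw [hb])
          refine ⟨by simp [bumpAll, bump, hx, hz, hyx, hzx, hb, hb'],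
            Or.inr (Or.inl ⟨a, b, b', hab, h4.trans hzb, ?_⟩)⟩
          simp [bumpAll, bump, hx, hz, hyx, hzx, hb, hb']
      · have hy : ¬ y ≤ a := fun hy => hx (hxy.le.trans hy)
        rw [bumpAll_cons_of_forall_not (s := (· ≤ ·)) (by simp_all),
          bumpAll_cons_of_forall_not (s := (· ≤ ·)) (by simp_all)]
        simpa using ih h2

theorem foldl_insertLines_knuth_zxy {x y z : α} (hxy : x ≤ y) (hyz : y < z) {L : List (List α)}
    (hL : ∀ c ∈ L, c.Pairwise (· < ·)) :
    [y, x, z].foldl (insertLines (· ≤ ·)) L = [y, z, x].foldl (insertLines (· ≤ ·)) L := by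
  induction L generalizing x y z with
  | nil => simp [insertLines, bump, hxy, not_le.2 hyz, not_le.2 (hxy.trans_lt hyz)]
  | cons c L ih =>
    obtain ⟨hc, hL⟩ := List.forall_mem_cons.1 hL
    rw [foldl_insertLines_cons, foldl_insertLines_cons]
    obtain ⟨h1, h2 | ⟨x', y', z', h2, h3, h4, h5⟩⟩ := bumpAll_knuth_zxy hxy hyz hc
    · rw [h1, h2]
    · rw [h1, h4, h5, ih h2 h3 hL]

theorem foldl_insertLines_knuth_yzx {x y z : α} (hxy : x < y) (hyz : y ≤ z) {L : List (List α)}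
    (hL : ∀ c ∈ L, c.Pairwise (· < ·)) :
    [x, z, y].foldl (insertLines (· ≤ ·)) L = [z, x, y].foldl (insertLines (· ≤ ·)) L := by
  induction L generalizing x y z with
  | nil => 
    simp [insertLines, bump, hyz, not_le.2 hxy, not_le.2 (hxy.trans_le hyz), (hxy.trans_le hyz).le]
  | cons c L ih =>
    obtain ⟨hc, hL⟩ := List.forall_mem_cons.1 hL
    rw [foldl_insertLines_cons, foldl_insertLines_cons]
    obtain ⟨h1, h2 | ⟨x', y', z', h2, h3, h4, h5⟩ | ⟨x', y', z', h2, h3, h4, h5⟩⟩ :=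
      bumpAll_knuth_yzx hxy hyz hc
    · rw [h1, h2]
    · rw [h1, h4, h5, ih h2 h3 hL]
    · rw [h1, h4, h5, foldl_insertLines_knuth_zxy h2 h3 hL]

end Columns

/-! ### Transposition -/

section Transpose

theorem Beside.length_le {s : α → α → Prop} :
    ∀ {l m : List α}, Beside s l m → m.length ≤ l.length
  | _, [], _ => by simp
  | [], _ :: _, h => h.elim
  | _ :: _, _ :: _, h => by simpa using h.2.length_le

theorem length_addColumn : ∀ (c : List α) (L : List (List α)),
    (addColumn c L).length = max c.length L.length
  | [], L => by simp [addColumn]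
  | a :: c, [] => by simp [addColumn, length_addColumn c []]
  | a :: c, l :: L => by simp [addColumn, length_addColumn c L]

theorem transposeLines_addColumn : ∀ {c : List α} {L : List (List α)}, c ≠ [] →
    L.length ≤ c.length → transposeLines (addColumn c L) = c :: transposeLines L
  | [a], [], _, _ => rfl
  | [a], [l], _, _ => rfl
  | [a], _ :: _ :: _, _, h => by simp at h
  | a :: b :: c, [], _, _ => by
    have h := transposeLines_addColumn (c := b :: c) (L := []) (by simp) (by simp)
    simp only [transposeLines, addColumn, List.foldr_cons] at h ⊢
    rw [h]
    rfl
  | a :: b :: c, l :: L, _, hL => by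
    have h := transposeLines_addColumn (c := b :: c) (L := L) (by simp) (by simpa using hL)
    rw [addColumn]
    simp only [transposeLines, List.foldr_cons] at h ⊢
    rw [h]
    rfl

theorem transposeLines_transposeLines {r s : α → α → Prop} {L : List (List α)}
    (hL : IsTableau r s L) : transposeLines (transposeLines L) = L := by
  -- The number of rows is carried along: peeling a column off requires it to be at least as long as
  -- those to its right.
  suffices h : transposeLines (transposeLines L) = L ∧
      (transposeLines L).length = (L.headD []).length from h.1
  induction L with
  | nil => exact ⟨rfl, rfl⟩
  | cons c L ih =>
    obtain ⟨⟨h1, -⟩, h3, h4⟩ := isTableau_cons.1 hL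
    obtain ⟨h5, h6⟩ := ih h4
    have h7 := h6.trans_le h3.length_le
    constructor
    · exact (transposeLines_addColumn h1 h7).trans (by rw [h5])
    · exact (length_addColumn c _).trans (max_eq_left h7)

end Transpose

/-! ### Products of readings in a monoid satisfying the Knuth relations -/

/-- The family `g` of elements of a monoid satisfies the Knuth relations. -/
structure SatisfiesKnuth [LinearOrder α] {M : Type*} [Monoid M] (g : α → M) : Prop where
  zxy : ∀ {x y z}, x ≤ y → y < z → g z * g x * g y = g x * g z * g y
  yzx : ∀ {x y z}, x < y → y ≤ z → g y * g z * g x = g y * g x * g z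

/-- The product of the column reading of a tableau given by its columns. -/
def columnProduct {M : Type*} [Monoid M] (g : α → M) (L : List (List α)) : M :=
  (L.map fun c => (c.reverse.map g).prod).prod

/-- The product of the row reading (from the last row to the first one) of a tableau given by its
rows. -/
def rowProduct {M : Type*} [Monoid M] (g : α → M) : List (List α) → M
  | [] => 1
  | l :: L => rowProduct g L * (l.map g).prod

namespace SatisfiesKnuth

variable [LinearOrder α] {M : Type*} [Monoid M] {g : α → M}

/-! ### Left insertion as left multiplication. -/

/-- The letter `x` moves right past the entries of `c`, bottom first; the entry just above, finally
`a`, serves as the third letter of each relation `zxy = xzy`. -/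
theorem mul_column_mul (hg : SatisfiesKnuth g) {x a : α} (hx : x ≤ a) {c : List α}
    (hc : (a :: c).Pairwise (· < ·)) :
    g x * (c.reverse.map g).prod * g a = (c.reverse.map g).prod * g x * g a := by
  induction c generalizing a with
  | nil => simp
  | cons b c ih =>
    obtain ⟨h1, h2⟩ := List.pairwise_cons.1 hc
    have hab : a < b := h1 b (by simp)
    have h3 := ih (hx.trans hab.le) h2
    have h4 := hg.zxy hx hab
    simp only [List.reverse_cons, List.map_append, List.prod_append, List.map_cons, List.map_nil,
      List.prod_cons, List.prod_nil, mul_one]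
    rw [← mul_assoc (g x), h3, mul_assoc _ (g x), mul_assoc, ← h4]
    simp only [mul_assoc]

theorem mul_column (hg : SatisfiesKnuth g) (x : α) {c : List α} (hc : c.Pairwise (· < ·)) :
    g x * (c.reverse.map g).prod = ((bump (· ≤ ·) x c).1.reverse.map g).prod *
      ((bump (· ≤ ·) x c).2.toList.map g).prod := by
  induction c with
  | nil => simp [bump]
  | cons a c ih =>
    obtain ⟨h1, h2⟩ := List.pairwise_cons.1 hc
    by_cases hx : x ≤ a
    · simpa [bump, hx, mul_assoc] using hg.mul_column_mul hx hc
    · have h3 := ih h2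
      have h4 := fun y => exists_bump_eq_cons (r := (· < ·)) (s := (· ≤ ·)) (x := x) (y := y)
        (l := c) (fun _ _ _ h h' => h.le.trans h') (fun _ _ => not_le.1)
      have h5 : ∀ b ∈ (bump (· ≤ ·) x c).1, a < b := fun b hb => by
        rcases bump_mem hb with rfl | hb
        · exact not_le.1 hx
        · exact h1 b hb
      rcases hb : bump (· ≤ ·) x c with ⟨c', _ | y⟩
      · rw [hb] at h3
        simp only [bump, hx, if_false, hb]
        simp only [List.reverse_cons, List.map_append, List.prod_append, ← mul_assoc, h3]
        simp
      · rw [hb] at h3 h4 h5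
        obtain ⟨b, m, rfl, hby⟩ := h4 y rfl
        -- The letter `y` bumped from below must still pass `a`; the top `b` of the new lower part
        -- stands just before it and permits `b y a = b a y`.
        have h6 := hg.yzx (h5 b (by simp)) hby
        simp only [bump, hx, if_false, hb]
        simp only [List.reverse_cons, List.map_append, List.prod_append, ← mul_assoc, h3]
        simp only [List.map_cons, List.map_nil, List.prod_cons, List.prod_nil, mul_one,
          Option.toList_some, mul_assoc] at h6 ⊢
        rw [h6]

theorem columnProduct_insertLines (hg : SatisfiesKnuth g) (x : α) {L : List (List α)}
    (hL : ∀ c ∈ L, c.Pairwise (· < ·)) :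
    columnProduct g (insertLines (· ≤ ·) L x) = g x * columnProduct g L := by
  induction L generalizing x with
  | nil => simp [insertLines, columnProduct]
  | cons c L ih =>
    obtain ⟨hc, hL⟩ := List.forall_mem_cons.1 hL
    have h1 := hg.mul_column x hc
    have h2 := fun y => ih y hL
    simp only [columnProduct] at h2 ⊢
    rcases hb : bump (· ≤ ·) x c with ⟨c', _ | y⟩ <;> rw [hb] at h1
    · simp only [insertLines, hb, List.map_cons, List.prod_cons, ← mul_assoc, h1]
      simp
    · simp only [insertLines, hb, List.map_cons, List.prod_cons, ← mul_assoc, h1, h2]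
      simp

/-! ### Right insertion as right multiplication, for the row reading. -/

/-- The letter `x` moves left through the row, the entry before the one it passes being the first
letter of `yzx = yxz`. -/
theorem mul_row_mul (hg : SatisfiesKnuth g) {x a : α} (hx : x < a) {l : List α}
    (hl : (a :: l).Pairwise (· ≤ ·)) :
    g a * (l.map g).prod * g x = g a * g x * (l.map g).prod := by
  induction l generalizing a with
  | nil => simp
  | cons b l ih =>
    obtain ⟨h1, h2⟩ := List.pairwise_cons.1 hl
    have hab : a ≤ b := h1 b (by simp)
    have h3 := ih (hx.trans_le hab) h2
    have h4 := hg.yzx hx hab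
    simp only [List.map_cons, List.prod_cons]
    rw [mul_assoc, h3]
    simp only [← mul_assoc, h4]

theorem row_mul (hg : SatisfiesKnuth g) (x : α) {l : List α} (hl : l.Pairwise (· ≤ ·)) :
    (l.map g).prod * g x = ((bump (· < ·) x l).2.toList.map g).prod *
      ((bump (· < ·) x l).1.map g).prod := by
  induction l with
  | nil => simp [bump]
  | cons a l ih =>
    obtain ⟨h1, h2⟩ := List.pairwise_cons.1 hl
    by_cases hx : x < a
    · simpa [bump, hx, mul_assoc] using hg.mul_row_mul hx hl
    · have h3 := ih h2
      have h4 := fun y => exists_bump_eq_cons (r := (· ≤ ·)) (s := (· < ·)) (x := x) (y := y)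
        (l := l) (fun _ _ _ => lt_of_le_of_lt) (fun _ _ => not_lt.1)
      have h5 : ∀ b ∈ (bump (· < ·) x l).1, a ≤ b := fun b hb => by
        rcases bump_mem hb with rfl | hb
        · exact not_lt.1 hx
        · exact h1 b hb
      rcases hb : bump (· < ·) x l with ⟨l', _ | y⟩
      · rw [hb] at h3
        simp only [bump, hx, if_false, hb, List.map_cons, List.prod_cons, mul_assoc, h3]
        simp
      · rw [hb] at h3 h4 h5
        obtain ⟨b, m, rfl, hby⟩ := h4 y rfl
        -- The bumped `y` leaves to the left past `a`, thanks to the next entry `b`: `a y b = y a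
        -- b`.
        have h6 := hg.zxy (h5 b (by simp)) hby
        simp only [bump, hx, if_false, hb, List.map_cons, List.prod_cons, mul_assoc, h3]
        simp only [List.map_cons, List.map_nil, List.prod_cons, List.prod_nil, mul_one,
          Option.toList_some, ← mul_assoc, h6]

theorem rowProduct_insertLines (hg : SatisfiesKnuth g) (x : α) {L : List (List α)}
    (hL : ∀ l ∈ L, l.Pairwise (· ≤ ·)) :
    rowProduct g (insertLines (· < ·) L x) = rowProduct g L * g x := by
  induction L generalizing x with
  | nil => simp [insertLines, rowProduct]
  | cons l L ih =>
    obtain ⟨hl, hL⟩ := List.forall_mem_cons.1 hL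
    have h1 := hg.row_mul x hl
    rcases hb : bump (· < ·) x l with ⟨l', _ | y⟩ <;> rw [hb] at h1
    · simp only [insertLines, hb, rowProduct, mul_assoc, h1]
      simp
    · simp only [insertLines, hb, rowProduct, mul_assoc, h1, ih y hL]
      simp

/-! ### The row and column readings have the same class. -/

theorem mul_row_mul_row (hg : SatisfiesKnuth g) {a : α} : ∀ {m l : List α},
    m.Pairwise (· ≤ ·) → (a :: l).Pairwise (· ≤ ·) → Beside (· < ·) l m →
    g a * (m.map g).prod * (l.map g).prod = (m.map g).prod * g a * (l.map g).prod
  | [], _, _, _, _ => by simp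
  | _ :: _, [], _, _, h => h.elim
  | b :: m, c :: l, hm, hl, h => by
    obtain ⟨h1, h2⟩ := List.pairwise_cons.1 hm
    obtain ⟨h3, h4⟩ := List.pairwise_cons.1 hl
    have hac : a ≤ c := h3 c (by simp)
    have h5 := mul_row_mul_row hg h2 h4 h.2
    have h6 := mul_row_mul_row hg h2 hl (beside_of_cons hm h)
    have h7 := hg.zxy hac h.1
    simp only [List.map_cons, List.prod_cons] at h6 ⊢
    -- The letter `c` is brought left past `m` to witness `a b c = b a c`, then sent back; after
    -- that `a` passes `m` with the whole row `c :: l` behind it.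
    calc g a * (g b * (m.map g).prod) * (g c * (l.map g).prod)
        = g a * g b * ((m.map g).prod * g c * (l.map g).prod) := by simp only [mul_assoc]
      _ = g a * g b * g c * (m.map g).prod * (l.map g).prod := by rw [← h5]; simp only [mul_assoc]
      _ = g b * g a * (g c * (m.map g).prod * (l.map g).prod) := by
        rw [← h7]; simp only [mul_assoc]
      _ = g b * (g a * (m.map g).prod * (g c * (l.map g).prod)) := by
        rw [h5]; simp only [mul_assoc]
      _ = g b * (m.map g).prod * g a * (g c * (l.map g).prod) := by
        rw [h6]; simp only [mul_assoc]
where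
  beside_of_cons {b : α} : ∀ {m l : List α}, (b :: m).Pairwise (· ≤ ·) →
      Beside (· < ·) l (b :: m) → Beside (· < ·) l m
    | [], _, _, _ => by simp [Beside]
    | _ :: _, [], _, h => h.elim
    | b' :: m, c :: l, hm, h =>
      ⟨lt_of_lt_of_le h.1 ((List.pairwise_cons.1 hm).1 b' (by simp)),
        beside_of_cons (List.pairwise_cons.1 hm).2 h.2⟩

/-- The letter `a` passes the rows below `l` from the last one up, each crossing being allowed by
the row just above. -/
theorem mul_rowProduct_mul_row (hg : SatisfiesKnuth g) {a : α} {l : List α} {L : List (List α)}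
    (hL : IsTableau (· ≤ ·) (· < ·) (l :: L)) (hl : (a :: l).Pairwise (· ≤ ·)) :
    g a * rowProduct g L * (l.map g).prod = rowProduct g L * g a * (l.map g).prod := by
  induction L generalizing l with
  | nil => simp [rowProduct]
  | cons m L ih =>
    obtain ⟨-, h3, h4⟩ := isTableau_cons.1 hL
    obtain ⟨⟨h5, h6⟩, -⟩ := isTableau_cons.1 h4
    have hm : (a :: m).Pairwise (· ≤ ·) := by
      refine List.pairwise_cons.2 ⟨fun y hy => ?_, h6⟩
      match l, m, h3, hy, h5, h6, hl with
      | _, [], _, _, h5, _, _ => exact absurd rfl h5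
      | [], _ :: _, h3, _, _, _, _ => exact h3.elim
      | c :: l, b :: m, h3, hy, _, h6, hl =>
        have hac : a ≤ c := (List.pairwise_cons.1 hl).1 c (by simp)
        have hab : a ≤ b := hac.trans (le_of_lt h3.1)
        rcases List.mem_cons.1 hy with rfl | hy
        · exact hab
        · exact hab.trans ((List.pairwise_cons.1 h6).1 y hy)
    have h7 := ih h4 hm
    have h8 := hg.mul_row_mul_row h6 hl h3
    rw [rowProduct, ← mul_assoc, h7, mul_assoc, mul_assoc, ← mul_assoc (g a), h8]
    simp only [mul_assoc]

/-- In the row reading each entry of the new column precedes its own row; it is moved left past all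
lower rows until the column stands in front. -/
theorem rowProduct_addColumn (hg : SatisfiesKnuth g) : ∀ (c : List α) (L : List (List α)),
    IsTableau (· ≤ ·) (· < ·) L → Beside (· ≤ ·) c (L.filterMap List.head?) →
    rowProduct g (addColumn c L) = (c.reverse.map g).prod * rowProduct g L
  | [], L, _, _ => by simp [addColumn]
  | a :: c, [], hL, _ => by
    have h := rowProduct_addColumn hg c [] hL (by simp [Beside])
    simp [addColumn, rowProduct, h]
  | a :: c, l :: L, hL, h => by
    obtain ⟨⟨h1, h2⟩, h3, h4⟩ := isTableau_cons.1 hL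
    cases l with
    | nil => exact absurd rfl h1
    | cons b l =>
      obtain ⟨hab, h⟩ : a ≤ b ∧ Beside (· ≤ ·) c (L.filterMap List.head?) := by
        simpa [Beside] using h
      have h5 := rowProduct_addColumn hg c L h4 h
      have h6 := hg.mul_rowProduct_mul_row (a := a) hL
        (List.pairwise_cons.2 ⟨fun z hz => by
          rcases List.mem_cons.1 hz with rfl | hz
          · exact hab
          · exact hab.trans ((List.pairwise_cons.1 h2).1 z hz), h2⟩)
      rw [addColumn, rowProduct, rowProduct, h5, List.map_cons, List.prod_cons, mul_assoc,
        ← mul_assoc _ (g a), ← h6]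
      simp [mul_assoc]

theorem rowProduct_transposeLines (hg : SatisfiesKnuth g) {L : List (List α)}
    (hL : IsTableau (· < ·) (· ≤ ·) L) :
    rowProduct g (transposeLines L) = columnProduct g L := by
  suffices h : rowProduct g (transposeLines L) = columnProduct g L ∧
      IsTableau (· ≤ ·) (· < ·) (transposeLines L) ∧
        (transposeLines L).filterMap List.head? = L.headD [] from h.1
  induction L with
  | nil => exact ⟨rfl, isTableau_nil _ _, rfl⟩
  | cons c L ih =>
    obtain ⟨⟨-, h2⟩, h3, h4⟩ := isTableau_cons.1 hL
    obtain ⟨h5, h6, h7⟩ := ih h4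
    refine ⟨?_, isTableau_addColumn (r := (· ≤ ·)) (fun _ _ _ => le_trans) c _ h2 h6 (h7 ▸ h3)⟩
    refine (hg.rowProduct_addColumn c _ h6 (h7 ▸ h3)).trans ?_
    rw [h5]
    simp [columnProduct]

end SatisfiesKnuth

end PlacticTableaux

/-! ### Young tableaux and the plactic monoid -/

theorem satisfiesKnuth_plactic (n : ℕ) : SatisfiesKnuth (PresentedMonoid.of (KnuthRel n)) where
  zxy h h' := PresentedMonoid.mk_eq_mk_of_rel (KnuthRel.zxy _ _ _ h h')
  yzx h h' := PresentedMonoid.mk_eq_mk_of_rel (KnuthRel.yzx _ _ _ h h')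

namespace YoungTableau

variable {n : ℕ}

/-- The class of the reading of a tableau in the plactic monoid. -/
def toPlactic (t : YoungTableau n) : PlacticMonoid n :=
  (t.readSW.map (PresentedMonoid.of (KnuthRel n))).prod

theorem toPlactic_eq_columnProduct (t : YoungTableau n) :
    t.toPlactic = columnProduct (PresentedMonoid.of (KnuthRel n)) t.1 := by
  simp only [toPlactic, readSW, columnProduct, List.map_flatten, List.prod_flatten, List.map_map]
  rfl

theorem toPlactic_leftInsert (t : YoungTableau n) (x : Fin n) :
    (t.leftInsert x).toPlactic = PresentedMonoid.of (KnuthRel n) x * t.toPlactic := by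
  rw [toPlactic_eq_columnProduct, toPlactic_eq_columnProduct]
  exact (satisfiesKnuth_plactic n).columnProduct_insertLines x fun c hc => (t.2.1 c hc).2

theorem toPlactic_rightInsert (t : YoungTableau n) (x : Fin n) :
    (t.rightInsert x).toPlactic = t.toPlactic * PresentedMonoid.of (KnuthRel n) x := by
  have hg := satisfiesKnuth_plactic n
  have ht := isTableau_transposeLines (r := (· < ·)) (s := (· ≤ ·)) (fun _ _ _ => le_trans) t.2
  have hx := isTableau_insertLines (r := (· ≤ ·)) (s := (· < ·)) (fun _ _ _ => lt_trans)
    (fun _ _ _ => lt_of_le_of_lt) (fun _ _ _ h h' => h.le.trans h') (fun _ _ => not_lt.1) ht x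
  -- Both classes are computed from row readings, as right insertion acts on rows.
  rw [toPlactic_eq_columnProduct, toPlactic_eq_columnProduct, ← hg.rowProduct_transposeLines t.2,
    ← hg.rowProduct_transposeLines (t.rightInsert x).2, rightInsert,
    transposeLines_transposeLines hx, hg.rowProduct_insertLines x fun l hl => (ht.1 l hl).2]

theorem val_insertWordLeft (u : List (Fin n)) (t : YoungTableau n) :
    (insertWordLeft leftInsert u t).1 = u.reverse.foldl (insertLines (· ≤ ·)) t.1 := by
  rw [List.foldl_reverse]
  induction u with
  | nil => rfl
  | cons x u ih => exact congrArg (insertLines (· ≤ ·) · x) ih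

/-- The action of the plactic monoid on tableaux by left insertion. -/
def leftAction (n : ℕ) : PlacticMonoid n →* Function.End (YoungTableau n) :=
  PresentedMonoid.lift (fun x t => t.leftInsert x) (by
    -- The last letter of a word acts first, so the triples appear reversed in the column lemmas.
    rintro _ _ (⟨x, y, z, h, h'⟩ | ⟨x, y, z, h, h'⟩) <;> funext t <;> apply Subtype.ext
    · exact (foldl_insertLines_knuth_zxy h h' fun c hc => (t.2.1 c hc).2)
    · exact foldl_insertLines_knuth_yzx h h' fun c hc => (t.2.1 c hc).2)

theorem leftAction_prod (u : List (Fin n)) (t : YoungTableau n) :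
    leftAction n (u.map (PresentedMonoid.of (KnuthRel n))).prod t =
      insertWordLeft leftInsert u t := by
  induction u with
  | nil => rfl
  | cons x u ih =>
    rw [List.map_cons, List.prod_cons, map_mul]
    exact congrArg (leftInsert · x) ih

theorem insertWordLeft_readSW (t : YoungTableau n) :
    insertWordLeft leftInsert t.readSW (empty n) = t := by
  obtain ⟨L, hL⟩ := t
  apply Subtype.ext
  rw [val_insertWordLeft]
  change (L.map List.reverse).flatten.reverse.foldl (insertLines (· ≤ ·)) [] = L
  induction L with
  | nil => rfl
  | cons c L ih =>
    -- The rightmost columns are inserted first; `c` then pushes the rebuilt tableau one column to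
    -- the right.
    rw [List.map_cons, List.flatten_cons, List.reverse_append, List.foldl_append,
      ih (isTableau_cons.1 hL).2.2, List.reverse_reverse, foldl_insertLines_column hL]

theorem toPlactic_empty : (empty n).toPlactic = 1 := rfl

theorem leftAction_toPlactic (t : YoungTableau n) : leftAction n t.toPlactic (empty n) = t :=
  (leftAction_prod _ _).trans (insertWordLeft_readSW t)

theorem toPlactic_injective : Function.Injective (toPlactic (n := n)) :=
  fun t t' h => by
  rw [← leftAction_toPlactic t, h, leftAction_toPlactic]

theorem toPlactic_insertWordLeft (u : List (Fin n)) (t : YoungTableau n) :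
    (insertWordLeft leftInsert u t).toPlactic =
      (u.map (PresentedMonoid.of (KnuthRel n))).prod * t.toPlactic := by
  induction u with
  | nil => simp [insertWordLeft]
  | cons x u ih =>
    rw [List.map_cons, List.prod_cons, mul_assoc, ← ih, ← toPlactic_leftInsert]
    rfl

theorem toPlactic_insertWordRight (u : List (Fin n)) (t : YoungTableau n) :
    (insertWordRight rightInsert t u).toPlactic =
      t.toPlactic * (u.map (PresentedMonoid.of (KnuthRel n))).prod := by
  induction u generalizing t with
  | nil => simp [insertWordRight]
  | cons x u ih =>
    rw [List.map_cons, List.prod_cons, ← mul_assoc, ← toPlactic_rightInsert, ← ih]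
    rfl

theorem toPlactic_insertionProduct (t t' : YoungTableau n) :
    (insertionProduct rightInsert readSW t t').toPlactic = t.toPlactic * t'.toPlactic :=
  toPlactic_insertWordRight _ _

theorem toPlactic_surjective : Function.Surjective (toPlactic (n := n)) := by
  intro m
  obtain ⟨w, rfl⟩ := PresentedMonoid.surjective_mk m
  refine ⟨insertWordLeft leftInsert w.toList (empty n), ?_⟩
  rw [toPlactic_insertWordLeft, toPlactic_empty, mul_one]
  induction w using FreeMonoid.inductionOn' with
  | one => rfl
  | of_mul x w ih =>
    rw [FreeMonoid.toList_of_mul, List.map_cons, List.prod_cons, ih, map_mul]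
    rfl

theorem readSW_injective : Function.Injective (readSW (n := n)) := fun t t' h => by
  rw [← insertWordLeft_readSW t, h, insertWordLeft_readSW]

theorem insertionsCommute : InsertionsCommute (rightInsert (n := n)) leftInsert := fun t x y =>
  toPlactic_injective (by
    simp only [toPlactic_leftInsert, toPlactic_rightInsert, mul_assoc])

theorem isLeftStringDataStructure :
    IsLeftStringDataStructure (empty n) leftInsert readSW where
  read_insert _ := rfl
  insert_read := insertWordLeft_readSW
  read_injective := readSW_injective
  read_empty := rfl

theorem isAssocRightStringDataStructure :
    IsAssocRightStringDataStructure (empty n) rightInsert readSW where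
  read_insert _ := rfl
  -- Comparing classes spares a direct analysis of how right insertion rebuilds a tableau.
  insert_read t := toPlactic_injective (by
    rw [toPlactic_insertWordRight, toPlactic_empty, one_mul, toPlactic])
  read_injective := readSW_injective
  read_empty := rfl
  product_assoc a b c := toPlactic_injective (by
    simp only [toPlactic_insertionProduct, mul_assoc])

end YoungTableau

theorem mainTheorem4 (n : ℕ) :
    IsLeftStringDataStructure (YoungTableau.empty n) YoungTableau.leftInsert YoungTableau.readSW ∧
    InsertionsCommute (YoungTableau.rightInsert (n := n)) YoungTableau.leftInsert ∧
    ∃ h : IsAssocRightStringDataStructure (YoungTableau.empty n) YoungTableau.rightInsert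
        YoungTableau.readSW,
      Nonempty (StructureMonoid h ≃* PlacticMonoid n) :=
  ⟨YoungTableau.isLeftStringDataStructure, YoungTableau.insertionsCommute,
    YoungTableau.isAssocRightStringDataStructure,
    ⟨MulEquiv.mk' (Equiv.ofBijective YoungTableau.toPlactic
      ⟨YoungTableau.toPlactic_injective, YoungTableau.toPlactic_surjective⟩)
      YoungTableau.toPlactic_insertionProduct⟩⟩
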